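/- All Hilbert spaces are finite dimensional. A \emph{rank-one quantum game} $G$ is given by unit vectors $|\psi\rangle,|\gamma\rangle\in\mathcal H_A\otimes\mathcal H_B\otimes\mathcal H_C$: the referee prepares $|\psi\rangle$ and sends the registers $A$ and $B$ to Alice and Bob; after they return them, the referee measures $(A,B,C)$ with $P_1=|\gamma\rangle\langle\gamma|$, $P_0=1-P_1$, and outcome $1$ means that the players win. Let $M_{AB}=\mathrm{tr}_C\,|\psi\rangle\langle\gamma|$. The \emph{maximal value} is $V(G)=\|M_{AB}\|_{S_1(\mathcal H_A\otimes\mathcal H_B)}^2$ (the square of the trace norm); it represents the supremum of the winning probability of a single player who applies a quantum operation (a completely positive, trace preserving map) to $\mathcal H_A\otimes\mathcal H_B$. The \emph{entangled value with one-way communication} $\omega_{qow}(G)$ is the supremum of the winning probability over all auxiliary spaces $\mathcal H_{A'}$ and all quantum operations $T_{AA'}$, $S_{BA'}$, where $A'$ is initialized in $|0\rangle$, Alice applies $T_{AA'}$ to $\mathcal H_A\otimes\mathcal H_{A'}$ and sends $A'$ to Bob, who applies $S_{BA'}$ to $\mathcal H_B\otimes\mathcal H_{A'}$: $$\omega_{qow}(G)=\sup_{A',T,S}\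 \mathrm{tr}\Big(\big(|\gamma\rangle\langle\gamma|\otimes 1_{A'}\big)\,(S_{BA'}\otimes \mathrm{id}_{AC})\,(T_{AA'}\otimes\mathrm{id}_{BC})\big(|\psi\rangle\langle\psi|\otimes|0\rangle\langle 0|\big)\Big).$$ The parallel repetition $G^2$ is the rank-one quantum game with initial state $|\psi\rangle\otimes|\psi\rangle$ and measurement state $|\gamma\rangle\otimes|\gamma\rangle$, Alice, Bob and the referee each holding both copies of their register. For $n\ge1$ let $G_{C+R}$ be the game with $\mathcal H_A=\mathcal H_B=\mathbb C^n$, $\mathcal H_C=\mathbb C^n\otimes\mathbb C^2$, $$|\psi\rangle=\frac1{\sqrt{2n}}\sum_{i=1}^n\big(|i1\rangle_{AB}|i1\rangle_C+|1i\rangle_{AB}|i2\rangle_C\big),\qquad |\gamma\rangle=\frac1{\sqrt{2n}}\sum_{i=1}^n\big(|1i\rangle_{AB}|i1\rangle_C+|i1\rangle_{AB}|i2\rangle_C\big).$$ \textbf{Lemma.} For every integer $n\ge 1$: \begin{enumerate} \item $V(G_{C+R})=V(G_{C+R}^2)=1$; also the supremum of the winning probability of a single player with access to both $\mathcal H_A$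 and $\mathcal H_B$ equals $1$ for $G_{C+R}$ and for $G_{C+R}^2$. \item $\omega_{qow}(G_{C+R})=\frac14\big(1+\frac1n\big)^2$ and $\omega_{qow}(G_{C+R}^2)=\frac1{16}\big(1+\frac1n\big)^4$. \end{enumerate} -/

import Mathlib

open scoped Kronecker Matrix ComplexOrder

noncomputable section

namespace QGame

section Operations

variable {X Y : Type} [Fintype X] [DecidableEq X] [Fintype Y] [DecidableEq Y]

/-- The map `T ⊗ id` on matrices over `ℂ^X ⊗ ℂ^E`: it applies `T` to each block
`(⟨e| ρ |e'⟩)`, a matrix over `ℂ^X`, for `e, e'` in the canonical basis of `ℂ^E`. -/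
def ampliate (T : Matrix X X ℂ →ₗ[ℂ] Matrix Y Y ℂ) {E : Type}
    (ρ : Matrix (X × E) (X × E) ℂ) : Matrix (Y × E) (Y × E) ℂ :=
  fun p q => T (fun x x' => ρ (x, p.2) (x', q.2)) p.1 q.1

/-- A quantum operation (quantum channel): a completely positive, trace preserving linear map. -/
structure IsQuantumOperation (T : Matrix X X ℂ →ₗ[ℂ] Matrix Y Y ℂ) : Prop where
  completelyPositive : ∀ (k : ℕ) (ρ : Matrix (X × Fin k) (X × Fin k) ℂ),
    ρ.PosSemidef → (ampliate T ρ).PosSemidef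
  tracePreserving : ∀ ρ : Matrix X X ℂ, (T ρ).trace = ρ.trace

/-- The rank-one operator `|v⟩⟨v|`. -/
def ketbra (v : X → ℂ) : Matrix X X ℂ := Matrix.vecMulVec v (star v)

/-- The trace norm (`S_1`-norm): the sum of the singular values of `M`, which are the square roots
of the eigenvalues of `Mᴴ M`. -/
def traceNorm (M : Matrix X X ℂ) : ℝ :=
  ∑ i, √((Matrix.isHermitian_conjTranspose_mul_self M).eigenvalues i)

end Operations

/-- A rank-one quantum game: an initial state `ψ` and a measurement state `γ`, unit vectors in
`H_A ⊗ H_B ⊗ H_C` with `H_A = ℂ^A`, `H_B = ℂ^B`, `H_C = ℂ^C`. -/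
structure RankOneGame (A B C : Type) [Fintype A] [Fintype B] [Fintype C] where
  ψ : A × B × C → ℂ
  γ : A × B × C → ℂ
  norm_ψ : ∑ x, ‖ψ x‖ ^ 2 = 1
  norm_γ : ∑ x, ‖γ x‖ ^ 2 = 1

namespace RankOneGame

section Values

variable {A B C : Type} [Fintype A] [DecidableEq A] [Fintype B] [DecidableEq B]
  [Fintype C] [DecidableEq C]

/-- The operator `M_AB = tr_C |ψ⟩⟨γ|` on `H_A ⊗ H_B`. -/
def M (G : RankOneGame A B C) : Matrix (A × B) (A × B) ℂ :=
  fun p q => ∑ c, G.ψ (p.1, p.2, c) * star (G.γ (q.1, q.2, c))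

/-- The maximal value `V(G) = ‖M_AB‖²` for the norm of `S_1(H_A ⊗ H_B)`. -/
def V (G : RankOneGame A B C) : ℝ := traceNorm G.M ^ 2

/-- Winning probability of one player who holds both registers `A` and `B` and applies the quantum
operation `T` to them: `tr (|γ⟩⟨γ| (T ⊗ id_C)(|ψ⟩⟨ψ|))`. -/
def singleWinProb (G : RankOneGame A B C)
    (T : Matrix (A × B) (A × B) ℂ →ₗ[ℂ] Matrix (A × B) (A × B) ℂ) : ℝ :=
  let ρ₀ : Matrix ((A × B) × C) ((A × B) × C) ℂ :=
    ketbra fun x => G.ψ (x.1.1, x.1.2, x.2)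
  let ρ₁ : Matrix (A × B × C) (A × B × C) ℂ :=
    (ampliate T ρ₀).submatrix (fun x => ((x.1, x.2.1), x.2.2)) (fun x => ((x.1, x.2.1), x.2.2))
  (ketbra G.γ * ρ₁).trace.re

/-- The optimal winning probability of one player with access to both `H_A` and `H_B`. -/
def singlePlayerValue (G : RankOneGame A B C) : ℝ :=
  sSup {p | ∃ T : Matrix (A × B) (A × B) ℂ →ₗ[ℂ] Matrix (A × B) (A × B) ℂ,
    IsQuantumOperation T ∧ p = G.singleWinProb T}

/-- Winning probability with one-way quantum communication. The auxiliary register `A'`, with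
`H_{A'} = ℂ^(d+1)`, starts in `|0⟩`. Alice applies `T` to `H_A ⊗ H_{A'}` and sends `A'` to Bob, who
applies `S` to `H_B ⊗ H_{A'}`; then `A, B, C` are measured with `P₁ = |γ⟩⟨γ|`:
`tr ((|γ⟩⟨γ| ⊗ 1_{A'}) (S ⊗ id_{AC}) (T ⊗ id_{BC}) (|ψ⟩|0⟩⟨ψ|⟨0|))`.
The `submatrix` operations only regroup the four registers. -/
def qowWinProb (G : RankOneGame A B C) (d : ℕ)
    (T : Matrix (A × Fin (d + 1)) (A × Fin (d + 1)) ℂ →ₗ[ℂ]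
      Matrix (A × Fin (d + 1)) (A × Fin (d + 1)) ℂ)
    (S : Matrix (B × Fin (d + 1)) (B × Fin (d + 1)) ℂ →ₗ[ℂ]
      Matrix (B × Fin (d + 1)) (B × Fin (d + 1)) ℂ) : ℝ :=
  let ρ₀ : Matrix ((A × Fin (d + 1)) × (B × C)) ((A × Fin (d + 1)) × (B × C)) ℂ :=
    ketbra fun x => G.ψ (x.1.1, x.2.1, x.2.2) * (if x.1.2 = 0 then 1 else 0)
  let toBob : (B × Fin (d + 1)) × (A × C) → (A × Fin (d + 1)) × (B × C) :=
    fun x => ((x.2.1, x.1.2), (x.1.1, x.2.2))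
  let ρ₁ : Matrix ((B × Fin (d + 1)) × (A × C)) ((B × Fin (d + 1)) × (A × C)) ℂ :=
    (ampliate T ρ₀).submatrix toBob toBob
  let toReferee : (A × B × C) × Fin (d + 1) → (B × Fin (d + 1)) × (A × C) :=
    fun x => ((x.1.2.1, x.2), (x.1.1, x.1.2.2))
  let ρ₂ : Matrix ((A × B × C) × Fin (d + 1)) ((A × B × C) × Fin (d + 1)) ℂ :=
    (ampliate S ρ₁).submatrix toReferee toReferee
  ((ketbra G.γ ⊗ₖ (1 : Matrix (Fin (d + 1)) (Fin (d + 1)) ℂ)) * ρ₂).trace.re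

/-- The entangled value with one-way communication (from Alice to Bob): the supremum of the winning
probability over all finite-dimensional `H_{A'}` and all quantum operations of Alice and Bob. -/
def omegaQow (G : RankOneGame A B C) : ℝ :=
  sSup {p | ∃ (d : ℕ)
    (T : Matrix (A × Fin (d + 1)) (A × Fin (d + 1)) ℂ →ₗ[ℂ]
      Matrix (A × Fin (d + 1)) (A × Fin (d + 1)) ℂ)
    (S : Matrix (B × Fin (d + 1)) (B × Fin (d + 1)) ℂ →ₗ[ℂ]
      Matrix (B × Fin (d + 1)) (B × Fin (d + 1)) ℂ),
    IsQuantumOperation T ∧ IsQuantumOperation S ∧ p = G.qowWinProb d T S}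

end Values

section Repetition

variable {A B C : Type} [Fintype A] [Fintype B] [Fintype C]

theorem sum_tensor (f : A × B × C → ℂ) (hf : ∑ x, ‖f x‖ ^ 2 = 1) :
    ∑ x : (A × A) × (B × B) × (C × C),
      ‖f (x.1.1, x.2.1.1, x.2.2.1) * f (x.1.2, x.2.1.2, x.2.2.2)‖ ^ 2 = 1 := by
  have h : ∑ x : (A × B × C) × (A × B × C), ‖f x.1 * f x.2‖ ^ 2 = 1 := by
    simp_rw [norm_mul, mul_pow]
    rw [Fintype.sum_prod_type]
    simp_rw [← Finset.mul_sum, hf, mul_one]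
    exact hf
  rw [← h]
  exact Fintype.sum_equiv
    ⟨fun x => ((x.1.1, x.2.1.1, x.2.2.1), (x.1.2, x.2.1.2, x.2.2.2)),
      fun y => ((y.1.1, y.2.1), (y.1.2.1, y.2.2.1), (y.1.2.2, y.2.2.2)),
      fun _ => rfl, fun _ => rfl⟩ _ _ (fun _ => rfl)

/-- The two-fold parallel repetition `G²`: the rank-one quantum game with initial state `ψ ⊗ ψ` and
measurement `(|γ⟩⟨γ|) ⊗ (|γ⟩⟨γ|)`, where each party holds both copies of its register. -/
def sq (G : RankOneGame A B C) : RankOneGame (A × A) (B × B) (C × C) where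
  ψ x := G.ψ (x.1.1, x.2.1.1, x.2.2.1) * G.ψ (x.1.2, x.2.1.2, x.2.2.2)
  γ x := G.γ (x.1.1, x.2.1.1, x.2.2.1) * G.γ (x.1.2, x.2.1.2, x.2.2.2)
  norm_ψ := sum_tensor _ G.norm_ψ
  norm_γ := sum_tensor _ G.norm_γ

end Repetition

end RankOneGame

section CR

variable (n : ℕ) [NeZero n]

/-- `(2n)^(-1/2) ∑_i (|i 1⟩_AB |i 1⟩_C + |1 i⟩_AB |i 2⟩_C)`, where `H_A = H_B = ℂ^n` and
`H_C = ℂ^n ⊗ ℂ^2`. The basis vector `|1⟩` of `ℂ^n` has index `0`, and `|1⟩, |2⟩` of `ℂ^2` have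
the indices `0, 1`. -/
def psiCR : Fin n × Fin n × (Fin n × Fin 2) → ℂ := fun x =>
  ((1 / √(2 * n) : ℝ) : ℂ) *
    ∑ i : Fin n, ((if x = (i, 0, (i, 0)) then 1 else 0) + (if x = (0, i, (i, 1)) then 1 else 0))

/-- `(2n)^(-1/2) ∑_i (|1 i⟩_AB |i 1⟩_C + |i 1⟩_AB |i 2⟩_C)`. -/
def gammaCR : Fin n × Fin n × (Fin n × Fin 2) → ℂ := fun x =>
  ((1 / √(2 * n) : ℝ) : ℂ) *
    ∑ i : Fin n, ((if x = (0, i, (i, 0)) then 1 else 0) + (if x = (i, 0, (i, 1)) then 1 else 0))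

theorem normCR_aux (f : Fin n × Fin n × (Fin n × Fin 2) → ℂ) (u v : Fin 2)
    (huv : (u = 0 ∧ v = 1) ∨ (u = 1 ∧ v = 0))
    (hf : ∀ x, f x = ((1 / √(2 * n) : ℝ) : ℂ) *
      ∑ i : Fin n, ((if x = (i, 0, (i, u)) then 1 else 0) +
        (if x = (0, i, (i, v)) then 1 else 0))) :
    ∑ x, ‖f x‖ ^ 2 = 1 := by
  have hn : (n : ℝ) ≠ 0 := Nat.cast_ne_zero.mpr (NeZero.ne n)
  have h1 : ∀ a b k, f (a, b, (k, u)) =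
      if a = k then (if b = 0 then ((1 / √(2 * n) : ℝ) : ℂ) else 0) else 0 := by
    intro a b k
    rw [hf]
    rcases huv with ⟨rfl, rfl⟩ | ⟨rfl, rfl⟩ <;>
    · by_cases ha : a = k <;> by_cases hb : b = 0 <;>
        simp [Prod.mk.injEq, ha, hb, ite_and]
      try exact fun h => absurd h.symm ha
  have h2 : ∀ a b k, f (a, b, (k, v)) =
      if b = k then (if a = 0 then ((1 / √(2 * n) : ℝ) : ℂ) else 0) else 0 := by
    intro a b k
    rw [hf]
    rcases huv with ⟨rfl, rfl⟩ | ⟨rfl, rfl⟩ <;>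
    · by_cases ha : a = 0 <;> by_cases hb : b = k <;>
        simp [Prod.mk.injEq, ha, hb, ite_and]
      try exact fun h => absurd h.symm hb
  have hs : ∀ g : Fin 2 → ℝ, ∑ s, g s = g u + g v := by
    intro g
    rcases huv with ⟨rfl, rfl⟩ | ⟨rfl, rfl⟩ <;> simp [Fin.sum_univ_two, add_comm]
  have hc : ‖((1 / √(2 * n) : ℝ) : ℂ)‖ ^ 2 = 1 / (2 * n) := by
    rw [Complex.norm_real, Real.norm_eq_abs, sq_abs, div_pow, Real.sq_sqrt (by positivity), one_pow]
  simp only [Fintype.sum_prod_type, hs, h1, h2, Finset.sum_add_distrib, apply_ite norm, norm_zero,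
    ite_pow, hc]
  simp [Finset.sum_ite_eq]
  field_simp
  norm_num

theorem norm_psiCR : ∑ x, ‖psiCR n x‖ ^ 2 = 1 :=
  normCR_aux n _ 0 1 (.inl ⟨rfl, rfl⟩) fun _ => rfl

theorem norm_gammaCR : ∑ x, ‖gammaCR n x‖ ^ 2 = 1 :=
  normCR_aux n _ 1 0 (.inr ⟨rfl, rfl⟩) fun x => by
    simp only [gammaCR, add_comm]

/-- The game `G_{C+R}`. -/
def gameCR : RankOneGame (Fin n) (Fin n) (Fin n × Fin 2) where
  ψ := psiCR n
  γ := gammaCR n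
  norm_ψ := norm_psiCR n
  norm_γ := norm_gammaCR n

end CR

end QGame

end

noncomputable section

namespace QGame

/-! ### Kraus representations of quantum operations. -/

section Kraus

/-! In Kraus form every winning probability is a sum of squared moduli of `tr (M F)`, with `F` the
operators applied to `A, B`, so the game enters only through `M_AB`. Here `M_AB` is the register
swap with nonnegative weights `m` (`IsSwapForm`). All values of such a game can be read off from
`m`, and swap forms are stable under tensor squares, where the weights multiply.

The trace norm is `∑ m`. A single player attains its square by swapping `A` and `B`; Minkowski's
inequality over the inputs shows that nothing does better.

With one-way communication Alice must return her register before seeing Bob's. If `m (a, x) ≤ m (a,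
a₀)`, it is optimal that she returns `a₀` and forwards `a`, which gives `(∑ a, m (a, a₀))²`. For
`G_{C+R}` the index `a₀` is `0` and the sum is `(n + 1) / (2 n)`; for the square it is the square of
this number. -/

theorem sum_comm_pairs {α β γ δ M : Type*} [Fintype α] [Fintype β] [Fintype γ] [Fintype δ]
    [AddCommMonoid M] (f : α → β → γ → δ → M) :
    ∑ a, ∑ b, ∑ c, ∑ d, f a b c d = ∑ c, ∑ d, ∑ a, ∑ b, f a b c d := by
  have h := Finset.sum_comm (s := (Finset.univ : Finset (α × β)))
    (t := (Finset.univ : Finset (γ × δ))) (f := fun p q => f p.1 p.2 q.1 q.2)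
  simpa only [Fintype.sum_prod_type] using h

variable {X Y : Type} [Fintype X] [DecidableEq X] [Fintype Y]

/-- The family `K` is a Kraus representation of the trace preserving map `T`. -/
structure IsKraus {R : Type} [Fintype R] (T : Matrix X X ℂ →ₗ[ℂ] Matrix Y Y ℂ)
    (K : R → Matrix Y X ℂ) : Prop where
  map_apply : ∀ ρ y y', T ρ y y' = ∑ r, ∑ x, ∑ x', ρ x x' * (K r y x * star (K r y' x'))
  orthonormal : ∀ x x', ∑ r, ∑ y, K r y x * star (K r y x') = if x = x' then 1 else 0

theorem sum_comm_rotate {α β γ M : Type*} [Fintype α] [Fintype β] [Fintype γ]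
    [AddCommMonoid M] (f : α → β → γ → M) :
    ∑ a, ∑ b, ∑ c, f a b c = ∑ c, ∑ a, ∑ b, f a b c := by
  rw [Finset.sum_comm (s := (Finset.univ : Finset γ))]
  exact Finset.sum_congr rfl fun a _ => Finset.sum_comm

/-- Choi's argument: `T ⊗ id` maps the unnormalized maximally entangled state to a positive
semidefinite matrix. The vectors of a rank-one decomposition, reshaped into matrices, are the Kraus
operators, since the blocks of that state are the matrix units. -/
theorem IsQuantumOperation.exists_kraus {T : Matrix X X ℂ →ₗ[ℂ] Matrix Y Y ℂ}
    (hT : IsQuantumOperation T) : ∃ (m : ℕ) (K : Fin m → Matrix Y X ℂ), IsKraus T K := by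
  let e := Fintype.equivFin X
  let ω : X × Fin (Fintype.card X) → ℂ := fun p => if e p.1 = p.2 then 1 else 0
  obtain ⟨m, v, hv⟩ := Matrix.posSemidef_iff_eq_sum_vecMulVec.mp
    (hT.completelyPositive _ (ketbra ω) (Matrix.posSemidef_vecMulVec_self_star ω))
  have key : ∀ x x' y y', T (Matrix.single x x' 1) y y'
      = ∑ r, v r (y, e x) * star (v r (y', e x')) := by
    intro x x' y y'
    have h := congrFun (congrFun hv (y, e x)) (y', e x')
    rw [Matrix.sum_apply] at h
    have h2 : (Matrix.single x x' 1 : Matrix X X ℂ)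
        = fun a a' => ketbra ω (a, e x) (a', e x') := by
      ext a a'
      simp only [Matrix.single_apply, ketbra, Matrix.vecMulVec_apply, ω, Pi.star_apply,
        EmbeddingLike.apply_eq_iff_eq, eq_comm (a := a), eq_comm (a := a')]
      by_cases h1 : x = a <;> by_cases h2 : x' = a' <;> simp [h1, h2]
    rw [h2]
    exact h
  have happ : ∀ ρ y y', T ρ y y'
      = ∑ x, ∑ x', ρ x x' * T (Matrix.single x x' 1) y y' := by
    intro ρ y y'
    conv_lhs => rw [Matrix.matrix_eq_sum_single ρ]
    have hs : ∀ x x', (Matrix.single x x' (ρ x x') : Matrix X X ℂ)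
        = ρ x x' • Matrix.single x x' 1 := by
      intro x x'; simp [Matrix.smul_single]
    simp only [hs, map_sum, map_smul, Matrix.sum_apply, Matrix.smul_apply, smul_eq_mul]
  refine ⟨m, fun r => Matrix.of fun y x => v r (y, e x), ?_, ?_⟩
  · intro ρ y y'
    rw [happ]
    simp only [key, Finset.mul_sum, Matrix.of_apply]
    exact sum_comm_rotate fun x x' r => ρ x x' * (v r (y, e x) * star (v r (y', e x')))
  · intro x x'
    have h := hT.tracePreserving (Matrix.single x x' 1)
    simp only [Matrix.trace, Matrix.diag_apply, key] at h
    simp only [Matrix.of_apply]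
    rw [Finset.sum_comm, h]
    by_cases hx : x = x'
    · subst hx; simp [Matrix.single_apply]
    · rw [if_neg hx]
      refine Finset.sum_eq_zero fun a _ => ?_
      rw [Matrix.single_apply, if_neg]
      rintro ⟨rfl, rfl⟩
      exact hx rfl

/-- The Kraus operators stacked on top of each other form an isometry. -/
theorem sum_norm_sq_family {R : Type} [Fintype R] (K : R → Matrix Y X ℂ)
    (hK : ∀ x x', ∑ r, ∑ y, K r y x * star (K r y x') = if x = x' then 1 else 0) (u : X → ℂ) :
    ∑ r, ∑ y, ‖∑ x, K r y x * u x‖ ^ 2 = ∑ x, ‖u x‖ ^ 2 := by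
  have hz : ∀ z : ℂ, ((‖z‖ ^ 2 : ℝ) : ℂ) = z * star z := by
    intro z
    rw [Complex.star_def, Complex.mul_conj, Complex.normSq_eq_norm_sq]
  apply Complex.ofReal_injective
  simp only [Complex.ofReal_sum, hz, star_sum, star_mul', Finset.sum_mul_sum]
  calc _ = ∑ x, ∑ x', (u x * star (u x')) * ∑ r, ∑ y, K r y x * star (K r y x') := by
        simp only [Finset.mul_sum]
        rw [sum_comm_pairs]
        refine Finset.sum_congr rfl fun _ _ => Finset.sum_congr rfl fun _ _ =>
          Finset.sum_congr rfl fun _ _ => Finset.sum_congr rfl fun _ _ => ?_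
        ring
    _ = _ := by simp only [hK, mul_ite, mul_one, mul_zero, Finset.sum_ite_eq, Finset.mem_univ,
          if_true]

theorem IsKraus.sum_norm_sq {R : Type} [Fintype R] {T : Matrix X X ℂ →ₗ[ℂ] Matrix Y Y ℂ}
    {K : R → Matrix Y X ℂ} (h : IsKraus T K) (u : X → ℂ) :
    ∑ r, ∑ y, ‖∑ x, K r y x * u x‖ ^ 2 = ∑ x, ‖u x‖ ^ 2 :=
  sum_norm_sq_family K h.orthonormal u

theorem IsKraus.sum_norm_sq_column {R : Type} [Fintype R]
    {T : Matrix X X ℂ →ₗ[ℂ] Matrix Y Y ℂ} {K : R → Matrix Y X ℂ} (h : IsKraus T K) (x : X) :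
    ∑ r, ∑ y, ‖K r y x‖ ^ 2 = 1 := by
  have := h.sum_norm_sq (fun x' => if x' = x then 1 else 0)
  simpa [apply_ite] using this

/-- Allowing a mixture of vectors `φ i` as input lets Bob's operation be applied to the output of
Alice's. -/
theorem IsKraus.ampliate_apply {R ι E : Type} [Fintype R] [Fintype ι]
    {T : Matrix X X ℂ →ₗ[ℂ] Matrix Y Y ℂ} {K : R → Matrix Y X ℂ} (h : IsKraus T K)
    {ρ : Matrix (X × E) (X × E) ℂ} {φ : ι → X × E → ℂ}
    (hρ : ∀ p q, ρ p q = ∑ i, φ i p * star (φ i q)) (p q : Y × E) :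
    ampliate T ρ p q = ∑ i, ∑ r, (∑ x, K r p.1 x * φ i (x, p.2)) *
      star (∑ x, K r q.1 x * φ i (x, q.2)) := by
  have hc : ∀ r i, (∑ x, K r p.1 x * φ i (x, p.2)) * star (∑ x, K r q.1 x * φ i (x, q.2)) =
      ∑ x, ∑ x', φ i (x, p.2) * star (φ i (x', q.2)) * (K r p.1 x * star (K r q.1 x')) := by
    intro r i
    rw [star_sum, Finset.sum_mul_sum]
    refine Finset.sum_congr rfl fun x _ => Finset.sum_congr rfl fun x' _ => ?_
    rw [star_mul']
    ring
  simp only [hc]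
  rw [Finset.sum_comm]
  refine (h.map_apply _ _ _).trans (Finset.sum_congr rfl fun r _ => ?_)
  simp only [hρ, Finset.sum_mul]
  exact sum_comm_rotate fun x x' i =>
    φ i (x, p.2) * star (φ i (x', q.2)) * (K r p.1 x * star (K r q.1 x'))

/-- The unitary channel that permutes the canonical basis. -/
def permChannel {X : Type} (σ : X ≃ X) : Matrix X X ℂ →ₗ[ℂ] Matrix X X ℂ :=
  (Matrix.reindexLinearEquiv ℂ ℂ σ σ).toLinearMap

theorem permChannel_apply {X : Type} (σ : X ≃ X) (ρ : Matrix X X ℂ) :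
    permChannel σ ρ = ρ.submatrix σ.symm σ.symm := rfl

theorem isQuantumOperation_permChannel {X : Type} [Fintype X] (σ : X ≃ X) : IsQuantumOperation (permChannel σ) where
  completelyPositive k ρ hρ := hρ.submatrix (Prod.map σ.symm id)
  tracePreserving ρ := by
    rw [permChannel_apply]
    exact Equiv.sum_comp σ.symm fun x => ρ x x

theorem isKraus_permChannel (σ : X ≃ X) :
    IsKraus (permChannel σ) fun (_ : Unit) => Matrix.of fun y x => if y = σ x then 1 else 0 where
  map_apply ρ y y' := by
    simp [permChannel_apply, ← Equiv.symm_apply_eq]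
  orthonormal x x' := by
    simp [eq_comm]

end Kraus

/-- Comparing roots of the characteristic polynomial identifies the eigenvalues as a multiset, so
their order plays no role. -/
theorem traceNorm_of_gram_diagonal {X : Type} [Fintype X] [DecidableEq X] (M : Matrix X X ℂ)
    (d : X → ℝ) (hd : ∀ x, 0 ≤ d x)
    (hM : Mᴴ * M = Matrix.diagonal fun x => ((d x ^ 2 : ℝ) : ℂ)) :
    traceNorm M = ∑ x, d x := by
  have h := (Matrix.isHermitian_conjTranspose_mul_self M).roots_charpoly_eq_eigenvalues
  rw [show (Mᴴ * M).charpoly = _ from congrArg _ hM, Matrix.charpoly_diagonal, Polynomial.roots_prod _ _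
    (Finset.prod_ne_zero_iff.mpr fun _ _ => Polynomial.X_sub_C_ne_zero _)] at h
  simp only [Polynomial.roots_X_sub_C, Multiset.bind_singleton] at h
  have h2 := congrArg (fun s => (s.map fun z : ℂ => √z.re).sum) h
  simp only [Multiset.map_map, Function.comp_def, Complex.ofReal_re, RCLike.ofReal_eq_complex_ofReal] at h2
  have h3 : ∑ x, √(d x ^ 2) = traceNorm M := h2
  rw [← h3]
  exact Finset.sum_congr rfl fun x _ => Real.sqrt_sq (hd x)

/-! ### Outcome probabilities of rank-one measurements. -/

section Trace

variable {X D ι : Type} [Fintype X] [Fintype D] [Fintype ι]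

theorem re_trace_ketbra_mul (γ : X → ℂ) (ρ : Matrix X X ℂ) (χ : ι → X → ℂ)
    (hρ : ∀ x y, ρ x y = ∑ i, χ i x * star (χ i y)) :
    (ketbra γ * ρ).trace.re = ∑ i, ‖∑ x, star (γ x) * χ i x‖ ^ 2 := by
  have hz : ∀ z : ℂ, ((‖z‖ ^ 2 : ℝ) : ℂ) = z * star z := by
    intro z
    rw [Complex.star_def, Complex.mul_conj, Complex.normSq_eq_norm_sq]
  have h : (ketbra γ * ρ).trace = ((∑ i, ‖∑ x, star (γ x) * χ i x‖ ^ 2 : ℝ) : ℂ) := by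
    simp only [Complex.ofReal_sum, hz, star_sum, Finset.sum_mul_sum]
    rw [← sum_comm_rotate]
    simp only [Matrix.trace, Matrix.diag_apply, Matrix.mul_apply, ketbra, Matrix.vecMulVec_apply,
      Pi.star_apply, hρ, Finset.mul_sum]
    rw [Finset.sum_comm]
    refine Finset.sum_congr rfl fun _ _ => Finset.sum_congr rfl fun _ _ =>
      Finset.sum_congr rfl fun _ _ => ?_
    rw [star_mul', star_star]
    ring
  rw [h, Complex.ofReal_re]

theorem re_trace_ketbra_kronecker_one_mul [DecidableEq D] (γ : X → ℂ)
    (ρ : Matrix (X × D) (X × D) ℂ) (χ : ι → X × D → ℂ)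
    (hρ : ∀ x y, ρ x y = ∑ i, χ i x * star (χ i y)) :
    ((ketbra γ ⊗ₖ (1 : Matrix D D ℂ)) * ρ).trace.re =
      ∑ i, ∑ w, ‖∑ x, star (γ x) * χ i (x, w)‖ ^ 2 := by
  have h : ((ketbra γ ⊗ₖ (1 : Matrix D D ℂ)) * ρ).trace =
      ∑ w, (ketbra γ * ρ.submatrix (fun x => (x, w)) (fun x => (x, w))).trace := by
    simp only [Matrix.trace, Matrix.diag_apply, Matrix.mul_apply, Fintype.sum_prod_type,
      Matrix.kroneckerMap_apply, Matrix.one_apply, mul_ite, mul_one, mul_zero, ite_mul, zero_mul,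
      Finset.sum_ite_eq, Finset.mem_univ, if_true, Matrix.submatrix_apply]
    rw [Finset.sum_comm]
  rw [h, Complex.re_sum, Finset.sum_comm]
  refine Finset.sum_congr rfl fun w _ => ?_
  exact re_trace_ketbra_mul γ _ (fun i x => χ i (x, w)) fun x y => hρ _ _

end Trace

/-! ### Winning probabilities in terms of `M_AB`. -/

namespace RankOneGame

variable {A B C : Type} [Fintype A] [DecidableEq A] [Fintype B] [DecidableEq B]
  [Fintype C]

/-- This is `⟨γ| F ⊗ 1_C |ψ⟩ = tr (M F)`. -/
theorem sum_star_γ_mul {A B C : Type} [Fintype A] [Fintype B] [Fintype C]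
    (G : RankOneGame A B C) (F : A × B → A × B → ℂ) :
    ∑ x : A × B × C, star (G.γ x) * ∑ p : A × B, F (x.1, x.2.1) p * G.ψ (p.1, p.2, x.2.2) =
      ∑ p, ∑ q, G.M p q * F q p := by
  have h : ∀ f : A × B × C → ℂ, ∑ x, f x = ∑ q : A × B, ∑ c, f (q.1, q.2, c) := by
    intro f
    simp only [Fintype.sum_prod_type]
  rw [h]
  simp only [M, Finset.mul_sum, Finset.sum_mul]
  rw [Finset.sum_comm (s := (Finset.univ : Finset (A × B)))
    (t := (Finset.univ : Finset (A × B))) (f := fun p q => ∑ c, _)]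
  refine Finset.sum_congr rfl fun q _ => ?_
  rw [Finset.sum_comm]
  refine Finset.sum_congr rfl fun p _ => Finset.sum_congr rfl fun c _ => ?_
  ring

theorem singleWinProb_eq_sum (G : RankOneGame A B C) {R : Type} [Fintype R]
    {T : Matrix (A × B) (A × B) ℂ →ₗ[ℂ] Matrix (A × B) (A × B) ℂ}
    {K : R → Matrix (A × B) (A × B) ℂ} (hK : IsKraus T K) :
    G.singleWinProb T = ∑ r, ‖∑ p, ∑ q, G.M p q * K r q p‖ ^ 2 := by
  have hF : ∀ r, ∑ p, ∑ q, G.M p q * K r q p = _ :=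
    fun r => (G.sum_star_γ_mul fun q p => K r q p).symm
  refine Eq.trans ?_ (Finset.sum_congr rfl fun r _ => by rw [hF r])
  refine re_trace_ketbra_mul G.γ _
    (fun r x => ∑ p : A × B, K r (x.1, x.2.1) p * G.ψ (p.1, p.2, x.2.2)) fun x y => ?_
  have := hK.ampliate_apply (ρ := ketbra fun x : (A × B) × C => G.ψ (x.1.1, x.1.2, x.2))
    (φ := fun (_ : Unit) x => G.ψ (x.1.1, x.1.2, x.2))
    (fun p q => by simp [ketbra, Matrix.vecMulVec_apply])
    ((x.1, x.2.1), x.2.2) ((y.1, y.2.1), y.2.2)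
  simpa using this

/-- Only the columns `(p.1, 0)` of Alice's operators occur, as `A'` starts in `|0⟩`. The final state
`w` of `A'` is not measured, so it is summed outside the modulus. -/
theorem qowWinProb_eq_sum (G : RankOneGame A B C) {R R' : Type} [Fintype R] [Fintype R'] (d : ℕ)
    {T : Matrix (A × Fin (d + 1)) (A × Fin (d + 1)) ℂ →ₗ[ℂ]
      Matrix (A × Fin (d + 1)) (A × Fin (d + 1)) ℂ}
    {S : Matrix (B × Fin (d + 1)) (B × Fin (d + 1)) ℂ →ₗ[ℂ]
      Matrix (B × Fin (d + 1)) (B × Fin (d + 1)) ℂ}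
    {K : R → Matrix (A × Fin (d + 1)) (A × Fin (d + 1)) ℂ}
    {L : R' → Matrix (B × Fin (d + 1)) (B × Fin (d + 1)) ℂ}
    (hK : IsKraus T K) (hL : IsKraus S L) :
    G.qowWinProb d T S = ∑ i : R × R', ∑ w, ‖∑ p, ∑ q, G.M p q *
      ∑ z, L i.2 (q.2, w) (p.2, z) * K i.1 (q.1, z) (p.1, 0)‖ ^ 2 := by
  simp only [← G.sum_star_γ_mul fun q p => ∑ z, L _ (q.2, _) (p.2, z) * K _ (q.1, z) (p.1, 0)]
  have hT := hK.ampliate_apply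
    (ρ := ketbra fun x : (A × Fin (d + 1)) × (B × C) =>
      G.ψ (x.1.1, x.2.1, x.2.2) * (if x.1.2 = 0 then 1 else 0))
    (φ := fun (_ : Unit) x => G.ψ (x.1.1, x.2.1, x.2.2) * (if x.1.2 = 0 then 1 else 0))
    (fun p q => by simp only [ketbra, Matrix.vecMulVec_apply, Finset.univ_unique, Finset.sum_const,
      Finset.card_singleton, one_smul, Pi.star_apply])
  simp only [Finset.univ_unique, Finset.sum_const, Finset.card_singleton, one_smul] at hT
  have hS := hL.ampliate_apply
    (ρ := (ampliate T (ketbra fun x : (A × Fin (d + 1)) × (B × C) =>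
      G.ψ (x.1.1, x.2.1, x.2.2) * (if x.1.2 = 0 then 1 else 0))).submatrix
        (fun x : (B × Fin (d + 1)) × (A × C) => ((x.2.1, x.1.2), (x.1.1, x.2.2)))
        (fun x : (B × Fin (d + 1)) × (A × C) => ((x.2.1, x.1.2), (x.1.1, x.2.2))))
    (φ := fun r x => ∑ y : A × Fin (d + 1), K r (x.2.1, x.1.2) y *
      (G.ψ (y.1, x.1.1, x.2.2) * (if y.2 = 0 then 1 else 0)))
    (fun p q => hT _ _)
  refine re_trace_ketbra_kronecker_one_mul G.γ _ (fun (i : R × R') x =>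
    ∑ p : A × B, (∑ z, L i.2 (x.1.2.1, x.2) (p.2, z) * K i.1 (x.1.1, z) (p.1, 0)) *
      G.ψ (p.1, p.2, x.1.2.2)) fun x y => ?_
  have hχ : ∀ (r : R) (s : R') (x : (A × B × C) × Fin (d + 1)),
      ∑ p : A × B, (∑ z, L s (x.1.2.1, x.2) (p.2, z) * K r (x.1.1, z) (p.1, 0)) *
        G.ψ (p.1, p.2, x.1.2.2) =
      ∑ v : B × Fin (d + 1), L s (x.1.2.1, x.2) v * ∑ y : A × Fin (d + 1), K r (x.1.1, v.2) y *
        (G.ψ (y.1, v.1, x.1.2.2) * (if y.2 = 0 then 1 else 0)) := by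
    intro r s x
    simp only [Fintype.sum_prod_type, mul_ite, mul_one, mul_zero, Finset.sum_ite_eq',
      Finset.mem_univ, if_true, Finset.sum_mul, Finset.mul_sum]
    rw [← sum_comm_rotate]
    refine Finset.sum_congr rfl fun _ _ => Finset.sum_congr rfl fun _ _ =>
      Finset.sum_congr rfl fun _ _ => ?_
    ring
  simp only [hχ, Fintype.sum_prod_type (f := fun i : R × R' => _)]
  exact hS _ _

/-- `M_AB` sends `|p⟩` to a multiple `m p` of the basis vector with the two registers exchanged. -/
def IsSwapForm (G : RankOneGame A A C) (m : A × A → ℝ) : Prop :=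
  ∀ p q, G.M p q = if q = p.swap then (m p : ℂ) else 0

variable {G : RankOneGame A A C} {m : A × A → ℝ}

theorem IsSwapForm.V_eq (h : G.IsSwapForm m) (hm : ∀ p, 0 ≤ m p) : G.V = (∑ p, m p) ^ 2 := by
  -- Column `p` of `M` has its only entry in row `p.swap`, hence the weight `m p.swap`.
  rw [V, traceNorm_of_gram_diagonal _ (fun p => m p.swap) (fun p => hm _)]
  · congr 1
    exact Equiv.sum_comp (Equiv.prodComm A A) m
  · ext p q
    rw [Matrix.mul_apply, Matrix.diagonal_apply]
    simp only [Matrix.conjTranspose_apply, h _ _]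
    have hs : ∀ x y : A × A, x = y.swap ↔ y = x.swap := by
      intro x y
      constructor <;> (rintro rfl; simp)
    simp only [hs]
    by_cases hpq : p = q
    · subst hpq
      simp [pow_two]
    · simp [hpq, Ne.symm hpq]

theorem IsSwapForm.singleWinProb_eq (h : G.IsSwapForm m) {R : Type} [Fintype R]
    {T : Matrix (A × A) (A × A) ℂ →ₗ[ℂ] Matrix (A × A) (A × A) ℂ}
    {K : R → Matrix (A × A) (A × A) ℂ} (hK : IsKraus T K) :
    G.singleWinProb T = ∑ r, ‖∑ p, (m p : ℂ) * K r p.swap p‖ ^ 2 := by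
  rw [G.singleWinProb_eq_sum hK]
  simp only [h _ _, ite_mul, zero_mul, Finset.sum_ite_eq', Finset.mem_univ, if_true]

theorem IsSwapForm.qowWinProb_eq (h : G.IsSwapForm m) {R R' : Type} [Fintype R] [Fintype R']
    (d : ℕ) {T S : Matrix (A × Fin (d + 1)) (A × Fin (d + 1)) ℂ →ₗ[ℂ]
      Matrix (A × Fin (d + 1)) (A × Fin (d + 1)) ℂ}
    {K : R → Matrix (A × Fin (d + 1)) (A × Fin (d + 1)) ℂ}
    {L : R' → Matrix (A × Fin (d + 1)) (A × Fin (d + 1)) ℂ}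
    (hK : IsKraus T K) (hL : IsKraus S L) :
    G.qowWinProb d T S = ∑ i : R × R', ∑ w, ‖∑ a, ∑ x, (m (a, x) : ℂ) *
      ∑ z, L i.2 (a, w) (x, z) * K i.1 (x, z) (a, 0)‖ ^ 2 := by
  rw [G.qowWinProb_eq_sum d hK hL]
  simp only [h _ _, ite_mul, zero_mul, Finset.sum_ite_eq', Finset.mem_univ, if_true]
  simp only [Fintype.sum_prod_type (f := fun p : A × A => _), Prod.swap_prod_mk]

end RankOneGame

/-- Minkowski's inequality for a finite sum of vectors, each of Euclidean norm at most `h a`. -/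
theorem sum_norm_sq_sum_le {ι α : Type} [Fintype ι] [Fintype α] (f : α → ι → ℂ) (h : α → ℝ)
    (h0 : ∀ a, 0 ≤ h a) (hf : ∀ a, ∑ i, ‖f a i‖ ^ 2 ≤ h a ^ 2) :
    ∑ i, ‖∑ a, f a i‖ ^ 2 ≤ (∑ a, h a) ^ 2 := by
  have h1 : ∀ g : ι → ℂ, ∑ i, ‖g i‖ ^ 2 = ‖WithLp.toLp 2 g‖ ^ 2 := fun g => by
    rw [EuclideanSpace.norm_sq_eq]
  have h2 : ∑ i, ‖∑ a, f a i‖ ^ 2 = ‖∑ a, WithLp.toLp 2 (f a)‖ ^ 2 := by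
    rw [← WithLp.toLp_sum, ← h1]
    simp
  rw [h2]
  gcongr
  refine (norm_sum_le _ _).trans (Finset.sum_le_sum fun a _ => ?_)
  exact le_of_sq_le_sq (by rw [← h1]; exact hf a) (h0 a)

/-! ### Values of games in swap form. -/

namespace RankOneGame

variable {A C : Type} [Fintype A] [DecidableEq A] [Fintype C]
  {G : RankOneGame A A C} {m : A × A → ℝ}

theorem IsSwapForm.singlePlayerValue_eq (h : G.IsSwapForm m) (hm : ∀ p, 0 ≤ m p) :
    G.singlePlayerValue = (∑ p, m p) ^ 2 := by
  refine IsGreatest.csSup_eq ⟨⟨_, isQuantumOperation_permChannel (Equiv.prodComm A A), ?_⟩, ?_⟩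
  · rw [h.singleWinProb_eq (isKraus_permChannel _)]
    simp only [Matrix.of_apply, Equiv.prodComm_apply, if_true, mul_one, Finset.univ_unique,
      Finset.sum_singleton]
    rw [← Complex.ofReal_sum, Complex.norm_real, Real.norm_eq_abs, sq_abs]
  · rintro _ ⟨T, hT, rfl⟩
    obtain ⟨k, K, hK⟩ := hT.exists_kraus
    rw [h.singleWinProb_eq hK]
    -- For fixed `p` the vector over `r` is `m p` times part of a unit column of the stacked Kraus
    -- operators.
    refine sum_norm_sq_sum_le (fun p r => (m p : ℂ) * K r p.swap p) m hm fun p => ?_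
    simp only [norm_mul, mul_pow, ← Finset.mul_sum, Complex.norm_real, Real.norm_eq_abs, sq_abs]
    refine mul_le_of_le_one_right (sq_nonneg _) ?_
    rw [← hK.sum_norm_sq_column p]
    exact Finset.sum_le_sum fun r _ =>
      Finset.single_le_sum (f := fun y => ‖K r y p‖ ^ 2) (fun _ _ => sq_nonneg _)
        (Finset.mem_univ p.swap)

theorem IsSwapForm.omegaQow_eq (h : G.IsSwapForm m) (hm : ∀ p, 0 ≤ m p) (a₀ : A)
    (ha₀ : ∀ a x, m (a, x) ≤ m (a, a₀)) : G.omegaQow = (∑ a, m (a, a₀)) ^ 2 := by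
  refine IsGreatest.csSup_eq ⟨?_, ?_⟩
  · obtain ⟨d, hd⟩ := Nat.exists_eq_succ_of_ne_zero (Fintype.card_pos_iff.mpr ⟨a₀⟩).ne'
    let e₁ : A ≃ Fin (d + 1) := Fintype.equivFinOfCardEq hd
    -- `A'` is a copy of `A` in which `a₀` is `|0⟩`: exchanging `A` with `A'` then leaves Alice with
    -- `a₀`.
    let e : A ≃ Fin (d + 1) := e₁.trans (Equiv.swap (e₁ a₀) 0)
    have he : e a₀ = 0 := by simp [e]
    let σ : A × Fin (d + 1) ≃ A × Fin (d + 1) :=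
      -- Both players exchange their register with `A'`.
      ⟨fun p => (e.symm p.2, e p.1), fun p => (e.symm p.2, e p.1), fun p => by simp,
        fun p => by simp⟩
    refine ⟨d, _, _, isQuantumOperation_permChannel σ, isQuantumOperation_permChannel σ, ?_⟩
    rw [h.qowWinProb_eq d (isKraus_permChannel σ) (isKraus_permChannel σ)]
    have he0 : e.symm 0 = a₀ := by rw [← he, e.symm_apply_apply]
    have hamp : ∀ w : Fin (d + 1), ∑ a, ∑ x, (m (a, x) : ℂ) * ∑ z : Fin (d + 1),
        (if (a, w) = σ (x, z) then 1 else 0) * (if (x, z) = σ (a, 0) then 1 else 0) =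
        -- Only `x = a₀` contributes, and Bob's exchange then leaves `A'` in `e a₀ = 0`.
        if w = 0 then ((∑ a, m (a, a₀) : ℝ) : ℂ) else 0 := by
      intro w
      simp only [σ, Equiv.coe_fn_mk, Prod.mk.injEq, he0, ite_and, mul_ite, mul_one, mul_zero]
      by_cases hw : w = 0
      · subst hw
        simp [he]
      · rw [if_neg hw]
        refine Finset.sum_eq_zero fun a _ => Finset.sum_eq_zero fun x _ => ?_
        convert mul_zero _
        refine Finset.sum_eq_zero fun z _ => ?_
        by_cases hx : x = a₀
        · have : w ≠ e x := by rw [hx, he]; exact hw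
          simp [this]
        · simp [hx]
    simp only [Matrix.of_apply, hamp]
    simp only [apply_ite norm, ite_pow,
      norm_zero, Finset.sum_ite_eq', Finset.mem_univ, if_true, ne_eq, OfNat.ofNat_ne_zero,
      not_false_eq_true, zero_pow, Complex.norm_real, Real.norm_eq_abs, sq_abs]
    simp
  · rintro _ ⟨d, T, S, hT, hS, rfl⟩
    obtain ⟨k, K, hK⟩ := hT.exists_kraus
    obtain ⟨l, L, hL⟩ := hS.exists_kraus
    rw [h.qowWinProb_eq d hK hL, ← Fintype.sum_prod_type']
    refine sum_norm_sq_sum_le (fun a (i : (Fin k × Fin l) × Fin (d + 1)) =>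
      ∑ x, (m (a, x) : ℂ) * ∑ z, L i.1.2 (a, i.2) (x, z) * K i.1.1 (x, z) (a, 0))
      (fun a => m (a, a₀)) (fun a => hm _) fun a => ?_
    simp only [Fintype.sum_prod_type (α₁ := Fin k × Fin l), Fintype.sum_prod_type (α₁ := Fin k)]
    -- Writing `1` as the squared norm of column `(a, 0)` of Alice's operators reduces the bound to
    -- one Kraus index `r` at a time.
    rw [← mul_one (m (a, a₀) ^ 2), ← hK.sum_norm_sq_column (a, 0), Finset.mul_sum]
    refine Finset.sum_le_sum fun r _ => ?_
    let u : A × Fin (d + 1) → ℂ := fun y => (m (a, y.1) : ℂ) * K r y (a, 0)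
    calc _ = ∑ s, ∑ w, ‖∑ y, L s (a, w) y * u y‖ ^ 2 := by
          refine Finset.sum_congr rfl fun s _ => Finset.sum_congr rfl fun w _ => ?_
          simp only [Fintype.sum_prod_type, u, Finset.mul_sum]
          congr 2
          refine Finset.sum_congr rfl fun x _ => Finset.sum_congr rfl fun z _ => ?_
          ring
      -- Adding Bob's outputs other than `a` completes the norm that his isometry preserves.
      _ ≤ ∑ s, ∑ y', ‖∑ y, L s y' y * u y‖ ^ 2 := by
          refine Finset.sum_le_sum fun s _ => ?_
          rw [Fintype.sum_prod_type (f := fun y' : A × Fin (d + 1) => _)]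
          exact Finset.single_le_sum (f := fun b => ∑ w, ‖∑ y, L s (b, w) y * u y‖ ^ 2)
            (fun _ _ => Finset.sum_nonneg fun _ _ => sq_nonneg _) (Finset.mem_univ a)
      _ = ∑ y, ‖u y‖ ^ 2 := hL.sum_norm_sq u
      _ ≤ _ := by
          rw [Finset.mul_sum]
          refine Finset.sum_le_sum fun y _ => ?_
          simp only [u, norm_mul, mul_pow, Complex.norm_real, Real.norm_eq_abs, sq_abs]
          gcongr
          · exact hm _
          · exact ha₀ _ _

theorem IsSwapForm.sq (h : G.IsSwapForm m) :
    G.sq.IsSwapForm fun p => m (p.1.1, p.2.1) * m (p.1.2, p.2.2) := by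
  intro p q
  have hM : G.sq.M p q =
      G.M (p.1.1, p.2.1) (q.1.1, q.2.1) * G.M (p.1.2, p.2.2) (q.1.2, q.2.2) := by
    simp only [M, Finset.sum_mul_sum, Fintype.sum_prod_type, RankOneGame.sq, star_mul']
    refine Finset.sum_congr rfl fun _ _ => Finset.sum_congr rfl fun _ _ => ?_
    ring
  rw [hM, h _ _, h _ _]
  obtain ⟨⟨p1, p2⟩, p3, p4⟩ := p
  obtain ⟨⟨q1, q2⟩, q3, q4⟩ := q
  simp only [Prod.swap_prod_mk, Prod.mk.injEq, ite_and]
  split_ifs <;> simp_all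

end RankOneGame

/-! ### The weights of `G_{C+R}`. -/

section CR

variable (n : ℕ) [NeZero n]

/-- The nonzero entries of `M_AB` for `G_{C+R}`. -/
def weightCR (p : Fin n × Fin n) : ℝ :=
  ((if p.2 = 0 then 1 else 0) + (if p.1 = 0 then 1 else 0)) / (2 * n)

/-- Tracing out `C` matches the index `i` and the branch, so `M_AB = (2n)⁻¹ ∑ i, (|i1⟩⟨1i| +
|1i⟩⟨i1|)`. Both branches meet at `|11⟩⟨11|`, where the weights add. -/
theorem isSwapForm_gameCR : (gameCR n).IsSwapForm (weightCR n) := by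
  rintro ⟨a, b⟩ ⟨a', b'⟩
  have hc : (((1 / √(2 * n) : ℝ) : ℂ)) * (((1 / √(2 * n) : ℝ) : ℂ)) = 1 / (2 * n) := by
    rw [← Complex.ofReal_mul, ← sq, div_pow, Real.sq_sqrt (by positivity)]
    push_cast
    ring
  have hψ1 : ∀ a b k, psiCR n (a, b, (k, 0)) =
      ((1 / √(2 * n) : ℝ) : ℂ) * (if k = a then (if b = 0 then 1 else 0) else 0) := by
    intro a b k
    by_cases hb : b = 0 <;> simp [psiCR, Prod.mk.injEq, ite_and, eq_comm (a := a), hb]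
  have hψ2 : ∀ a b k, psiCR n (a, b, (k, 1)) =
      ((1 / √(2 * n) : ℝ) : ℂ) * (if k = b then (if a = 0 then 1 else 0) else 0) := by
    intro a b k
    by_cases ha : a = 0 <;> simp [psiCR, Prod.mk.injEq, ite_and, eq_comm (a := b), ha]
  have hγ1 : ∀ a b k, gammaCR n (a, b, (k, 0)) =
      ((1 / √(2 * n) : ℝ) : ℂ) * (if k = b then (if a = 0 then 1 else 0) else 0) := by
    intro a b k
    by_cases ha : a = 0 <;> simp [gammaCR, Prod.mk.injEq, ite_and, eq_comm (a := b), ha]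
  have hγ2 : ∀ a b k, gammaCR n (a, b, (k, 1)) =
      ((1 / √(2 * n) : ℝ) : ℂ) * (if k = a then (if b = 0 then 1 else 0) else 0) := by
    intro a b k
    by_cases hb : b = 0 <;> simp [gammaCR, Prod.mk.injEq, ite_and, eq_comm (a := a), hb]
  have hr : ∀ (x : ℝ) (u v : ℂ), (x : ℂ) * u * (x * v) = x * x * (u * v) := by
    intros; ring
  have hstar : ∀ (x : ℝ) (P Q : Prop) [Decidable P] [Decidable Q],
      star ((x : ℂ) * (if P then (if Q then 1 else 0) else 0)) =
        x * (if P then (if Q then 1 else 0) else 0) := by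
    intro x P Q _ _
    split_ifs <;> simp
  have hM : (gameCR n).M (a, b) (a', b') =
      ∑ k, (psiCR n (a, b, (k, 0)) * star (gammaCR n (a', b', (k, 0))) +
        psiCR n (a, b, (k, 1)) * star (gammaCR n (a', b', (k, 1)))) := by
    simp only [RankOneGame.M, Fintype.sum_prod_type, Fin.sum_univ_two]
    rfl
  rw [hM]
  simp only [hψ1, hψ2, hγ1, hγ2, hstar, hr, hc, Finset.sum_add_distrib, ← Finset.mul_sum, ite_mul, zero_mul,
    Finset.sum_ite_eq', Finset.mem_univ, if_true, one_mul, Prod.swap_prod_mk, Prod.mk.injEq,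
    weightCR]
  by_cases h1 : a = b'
  · subst h1
    by_cases h2 : b = a'
    · subst h2
      by_cases h3 : b = 0 <;> by_cases h4 : a = 0 <;> simp [h3, h4] <;> ring
    · have h3 : b = 0 → ¬a' = 0 := fun hb ha => h2 (hb.trans ha.symm)
      by_cases hb : b = 0
      · simp [h2, Ne.symm h2, h3 hb]
      · simp [h2, Ne.symm h2, hb]
  · have h3 : a = 0 → ¬b' = 0 := fun ha hb => h1 (ha.trans hb.symm)
    by_cases ha : a = 0
    · simp [h1, Ne.symm h1, h3 ha]
    · simp [h1, Ne.symm h1, ha]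

theorem weightCR_nonneg (p : Fin n × Fin n) : 0 ≤ weightCR n p := by
  unfold weightCR
  positivity

theorem weightCR_le (a x : Fin n) : weightCR n (a, x) ≤ weightCR n (a, 0) := by
  unfold weightCR
  gcongr
  by_cases h : x = 0 <;> simp [h]

theorem sum_weightCR_column : ∑ a : Fin n, weightCR n (a, 0) = 1 / 2 * (1 + 1 / (n : ℝ)) := by
  have hn : (n : ℝ) ≠ 0 := Nat.cast_ne_zero.mpr (NeZero.ne n)
  simp only [weightCR, ← Finset.sum_div, Finset.sum_add_distrib, if_true, Finset.sum_const,
    Finset.card_univ, Fintype.card_fin, Finset.sum_ite_eq', Finset.mem_univ, nsmul_eq_mul, mul_one]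
  field_simp

theorem sum_weightCR : ∑ p, weightCR n p = 1 := by
  have hn : (n : ℝ) ≠ 0 := Nat.cast_ne_zero.mpr (NeZero.ne n)
  have h : ∑ p : Fin n × Fin n, (if p.1 = 0 then (1 : ℝ) else 0) = n := by
    rw [Fintype.sum_prod_type, Finset.sum_comm]
    simp
  have h' : ∑ p : Fin n × Fin n, (if p.2 = 0 then (1 : ℝ) else 0) = n := by
    rw [Fintype.sum_prod_type]
    simp
  simp only [weightCR, ← Finset.sum_div, Finset.sum_add_distrib, h, h']
  field_simp
  norm_num

end CR

end QGame

end

theorem mainTheorem11 (n : ℕ) [NeZero n] :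
    ((QGame.gameCR n).V = 1 ∧ (QGame.gameCR n).sq.V = 1) ∧
    ((QGame.gameCR n).singlePlayerValue = 1 ∧ (QGame.gameCR n).sq.singlePlayerValue = 1) ∧
    (QGame.gameCR n).omegaQow = 1 / 4 * (1 + 1 / (n : ℝ)) ^ 2 ∧
    (QGame.gameCR n).sq.omegaQow = 1 / 16 * (1 + 1 / (n : ℝ)) ^ 4 := by
  have h := QGame.isSwapForm_gameCR n
  have h0 := QGame.weightCR_nonneg n
  have h0' : ∀ p : (Fin n × Fin n) × (Fin n × Fin n),
      0 ≤ QGame.weightCR n (p.1.1, p.2.1) * QGame.weightCR n (p.1.2, p.2.2) :=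
    fun p => mul_nonneg (h0 _) (h0 _)
  have hsum : ∑ p : (Fin n × Fin n) × (Fin n × Fin n),
      QGame.weightCR n (p.1.1, p.2.1) * QGame.weightCR n (p.1.2, p.2.2) = 1 := by
    -- Regrouping the registers by copies of the game factorizes the sum.
    refine (Equiv.sum_comp (Equiv.prodProdProdComm (Fin n) (Fin n) (Fin n) (Fin n))
      fun q => QGame.weightCR n q.1 * QGame.weightCR n q.2).trans ?_
    rw [Fintype.sum_prod_type]
    simp only [← Finset.mul_sum, QGame.sum_weightCR, mul_one]
  refine ⟨⟨?_, ?_⟩, ⟨?_, ?_⟩, ?_, ?_⟩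
  · rw [h.V_eq h0, QGame.sum_weightCR, one_pow]
  · rw [h.sq.V_eq h0', hsum, one_pow]
  · rw [h.singlePlayerValue_eq h0, QGame.sum_weightCR, one_pow]
  · rw [h.sq.singlePlayerValue_eq h0', hsum, one_pow]
  · rw [h.omegaQow_eq h0 0 (QGame.weightCR_le n), QGame.sum_weightCR_column]
    ring
  · rw [h.sq.omegaQow_eq h0' (0, 0) fun a x => mul_le_mul (QGame.weightCR_le n _ _)
      (QGame.weightCR_le n _ _) (h0 _) (h0 _)]
    rw [Fintype.sum_prod_type]
    simp only [← Finset.mul_sum, ← Finset.sum_mul, QGame.sum_weightCR_column]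
    ring
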